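/- **Setting.** Let $b(N)\ge 1$ ($N\in\mathbb N$) be bit lengths. A likelihood function on $\{1,\dots,N\}$ assigns to every $x$ a number $P(E|x)\in[0,1]$ given by a $b(N)$-bit string, read as a binary number $y_0.y_1y_2\dots$; its oracle is the unitary $O_E|x\rangle|y\rangle=|x\rangle|y\oplus P(E|x)\rangle$. For a unit vector $\alpha=\sum_{x=1}^N\alpha_x|x\rangle$ put $q=\sum_x|\alpha_x|^2P(E|x)$. If $q>0$, a *quantum Bayesian update* of $\alpha$ produces the posterior state $q^{-1/2}\sum_x\alpha_x\sqrt{P(E|x)}\,|x\rangle$. A bound $\Gamma_E$ with $\max_xP(E|x)\le\Gamma_E\le1$, $\Gamma_E>0$, is known to all algorithms. Algorithms act on the system register, the answer register and a workspace of finite (possibly growing) dimension; they alternate arbitrary oracle-independent isometries with calls of $O_E$. A *heralded* algorithm makes a fixed number of queries and then measures a flag in the workspace that indicates success or failure. An *adaptive* algorithm measures, initially and after every query, whether to stop; its average number of queries is the expectation over its measurement outcomes. All requirements below are for all $N$, all $\Gamma_E$, and all $\alpha$ and $O_E$ with $q>0$ and $\max_xP(E|x)\le\Gamma_E$. **Theorem.**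 Let $F$ be a (family, in $N$ and $\Gamma_E$, of) heralded algorithm(s) that, upon success, performs a quantum Bayesian update of an arbitrary input state $\alpha$, uses $O(1)$ queries to $O_E$ (at most a constant independent of $N$ and $\Gamma_E$), and has success probability $\Omega(q/\Gamma_E)$, i.e. at least $c\,q/\Gamma_E$ for a constant $c>0$ and all large $N$. Then the following do not exist. 1. A heralded algorithm $G$ that, upon success, performs a quantum Bayesian update of $\alpha$, uses $O(1)$ queries, and has success probability $\omega(q/\Gamma_E)$ as $N\to\infty$ and $q/\Gamma_E\to0$: for every $K$ there are $\delta>0$ and $N_0$ such that the success probability is at least $Kq/\Gamma_E$ whenever $N\ge N_0$ and $q/\Gamma_E\le\delta$. This holds even if $G$ may be tailored to $\alpha$. 2. An adaptive algorithm $H$ that undoes the effect of $F$ upon a failed update with $o(\sqrt N/\log N)$ queries: whenever $F$, applied to $\alpha$, has non-zero failure probability, $H$, started in the state of all registers of $F$ after the failure, returns the system register to the state $\alpha$ with probability one, using on average at most $h(N)$ queries, where $h(N)=o(\sqrt N/\log N)$. Here $\alpha$ may itself depend on the oracle (e.g. be the result of earlier updates), and the claim holds even if $H$ may be tailored to the function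 $O_E\mapsto\alpha(O_E)$, though not to $O_E$ itself. 3. An adaptive algorithm $I$ that, with probability one, performs a quantum Bayesian update of $\alpha$ and, for all $O_E$, uses on average at most $h(N)$ queries, where $h(N)=o(\sqrt N)$. This holds even if $I$ may be tailored to $\alpha$. -/

import Mathlib

open Filter Asymptotics

noncomputable section

namespace QBayes

/-! ### Registers, likelihood functions and the oracle -/

/-- The Hilbert space with orthonormal basis `|i⟩`, `i : ι`. -/
abbrev Space (ι : Type) [Fintype ι] : Type := EuclideanSpace ℂ ι

/-- Bit strings of length `b`. -/
abbrev Bits (b : ℕ) : Type := Fin b → Bool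

/-- Bitwise exclusive or. -/
def bxor {b : ℕ} (y z : Bits b) : Bits b := fun i => xor (y i) (z i)

/-- The number whose binary expansion is `y₀.y₁y₂…`, that is, `∑ᵢ yᵢ 2⁻ⁱ`. -/
def bitValue {b : ℕ} (y : Bits b) : ℝ := ∑ i : Fin b, if y i then (1 / 2 : ℝ) ^ (i : ℕ) else 0

/-- The data behind an oracle: for each `x` the bit string that encodes `P(E|x)`. -/
abbrev Table (N b : ℕ) : Type := Fin N → Bits b

/-- The likelihood `P(E|x)` encoded by a table. -/
def likelihood {N b : ℕ} (P : Table N b) (x : Fin N) : ℝ := bitValue (P x)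

/-- `∑ₓ |αₓ|² P(E|x)`. -/
def evidence {N b : ℕ} (P : Table N b) (α : Space (Fin N)) : ℝ :=
  ∑ x, ‖α x‖ ^ 2 * likelihood P x

/-- The result `∑ₓ αₓ √P(E|x) |x⟩ / √(∑ₓ |αₓ|² P(E|x))` of a quantum Bayesian update. -/
def posterior {N b : ℕ} (P : Table N b) (α : Space (Fin N)) : Space (Fin N) :=
  WithLp.toLp 2 fun x => ((√(likelihood P x) / √(evidence P α) : ℝ) : ℂ) * α x

/-- The situations in which a quantum Bayesian update is asked for: `α` is a pure state,
`max P(E|x) ≤ Γ ≤ 1`, and the posterior is defined. -/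
structure Admissible {N b : ℕ} (Γ : ℝ) (P : Table N b) (α : Space (Fin N)) : Prop where
  bound_pos : 0 < Γ
  bound_le_one : Γ ≤ 1
  likelihood_le : ∀ x, likelihood P x ≤ Γ
  unit : ‖α‖ = 1
  evidence_pos : 0 < evidence P α

/-- Basis labels of a machine whose workspace has dimension `w`: system register `x`,
answer register `y`, workspace. -/
abbrev Reg (N b w : ℕ) : Type := Fin N × Bits b × Fin w

/-- The permutation `(x, y, s) ↦ (x, y ⊕ P(E|x), s)` of basis labels. -/
def oraclePerm {N b : ℕ} (P : Table N b) (w : ℕ) : Equiv.Perm (Reg N b w) :=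
  Function.Involutive.toPerm (fun r => (r.1, bxor r.2.1 (P r.1), r.2.2)) (by
    rintro ⟨x, y, s⟩
    have h : bxor (bxor y (P x)) (P x) = y := by
      funext i
      simp [bxor]
    simp [h])

/-- The oracle `O_E |x⟩|y⟩|s⟩ = |x⟩|y ⊕ P(E|x)⟩|s⟩`. -/
def oracle {N b : ℕ} (P : Table N b) (w : ℕ) : Space (Reg N b w) ≃ₗᵢ[ℂ] Space (Reg N b w) :=
  LinearIsometryEquiv.piLpCongrLeft 2 ℂ ℂ (oraclePerm P w)

theorem oracle_single {N b w : ℕ} (P : Table N b) (x : Fin N) (y : Bits b) (s : Fin w) :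
    oracle P w (EuclideanSpace.single (x, y, s) 1) =
      EuclideanSpace.single (x, bxor y (P x), s) 1 := by
  simp only [oracle, EuclideanSpace.single]
  exact LinearIsometryEquiv.piLpCongrLeft_single _ _ _

/-- The component of `ψ` in which the workspace is in one of the basis states of `S`. -/
def component {N b w : ℕ} (S : Set (Fin w)) (ψ : Space (Reg N b w)) : Space (Reg N b w) :=
  open Classical in WithLp.toLp 2 fun r => if r.2.2 ∈ S then ψ r else 0

/-- `ψ = target ⊗ φ` for some (unnormalised) state `φ` of the other registers: if `ψ ≠ 0`, the
reduced state of the system register is the pure state `target`. -/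
def SystemIs {N b w : ℕ} (target : Space (Fin N)) (ψ : Space (Reg N b w)) : Prop :=
  ∃ φ : Bits b × Fin w → ℂ, ∀ x r, ψ (x, r) = target x * φ r

/-! ### Query algorithms -/

/-- The oracle-independent part of a query algorithm whose input has basis labels `κ`: an
arbitrary isometry before the first query and an arbitrary isometry after each query. Fresh
workspace may be added at any time, so that measurements and classical control are covered. -/
structure Circuit (κ : Type) [Fintype κ] (N b : ℕ) where
  /-- dimension of the workspace after `t` queries -/
  w : ℕ → ℕ
  start : Space κ →ₗᵢ[ℂ] Space (Reg N b (w 0))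
  step : ∀ t, Space (Reg N b (w t)) →ₗᵢ[ℂ] Space (Reg N b (w (t + 1)))

/-- A heralded algorithm: it makes a fixed number of queries, and then measures whether the
workspace is in one of the basis states of `success`. -/
structure Heralded (κ : Type) [Fintype κ] (N b : ℕ) extends Circuit κ N b where
  queries : ℕ
  success : Set (Fin (w queries))

/-- An algorithm with a variable number of queries: initially and after each query it measures
whether the workspace is in one of the basis states of `halt t` (`t` the number of queries
made so far); if so it stops, otherwise it makes another query. -/
structure Adaptive (κ : Type) [Fintype κ] (N b : ℕ) extends Circuit κ N b where
  halt : ∀ t, Set (Fin (w t))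

section Runs

variable {κ : Type} [Fintype κ] {N b : ℕ}

/-- The state after `t` queries, without any measurement. -/
def Circuit.run (A : Circuit κ N b) (P : Table N b) (v : Space κ) :
    (t : ℕ) → Space (Reg N b (A.w t))
  | 0 => A.start v
  | t + 1 => A.step t (oracle P _ (A.run P v t))

/-- The unnormalised state upon success. -/
def Heralded.succeeded (A : Heralded κ N b) (P : Table N b) (v : Space κ) :
    Space (Reg N b (A.w A.queries)) :=
  component A.success (A.run P v A.queries)

/-- The unnormalised state upon failure. -/
def Heralded.failed (A : Heralded κ N b) (P : Table N b) (v : Space κ) :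
    Space (Reg N b (A.w A.queries)) :=
  component A.successᶜ (A.run P v A.queries)

/-- The success probability on the unit vector `v`. -/
def Heralded.successProb (A : Heralded κ N b) (P : Table N b) (v : Space κ) : ℝ :=
  ‖A.succeeded P v‖ ^ 2

/-- The normalised state upon failure. -/
def Heralded.failedState (A : Heralded κ N b) (P : Table N b) (v : Space κ) :
    Space (Reg N b (A.w A.queries)) :=
  ((‖A.failed P v‖⁻¹ : ℝ) : ℂ) • A.failed P v

/-- The unnormalised state of the branch that makes at least `t` queries, after the `t`-th query
and before the measurement that follows it. -/
def Adaptive.branch (A : Adaptive κ N b) (P : Table N b) (v : Space κ) :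
    (t : ℕ) → Space (Reg N b (A.w t))
  | 0 => A.start v
  | t + 1 => A.step t (oracle P _ (component (A.halt t)ᶜ (A.branch P v t)))

/-- The unnormalised final state of the branch that stops after exactly `t` queries. -/
def Adaptive.stopped (A : Adaptive κ N b) (P : Table N b) (v : Space κ) (t : ℕ) :
    Space (Reg N b (A.w t)) :=
  component (A.halt t) (A.branch P v t)

/-- The expected number of queries on the unit vector `v`: the sum over `t` of the probability
that the query number `t + 1` is made. It is `∞` unless `A` stops with probability one. -/
def Adaptive.expectedQueries (A : Adaptive κ N b) (P : Table N b) (v : Space κ) : ENNReal :=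
  ∑' t, ENNReal.ofReal (‖component (A.halt t)ᶜ (A.branch P v t)‖ ^ 2)

end Runs

/-! ### What the algorithms are asked to do -/

/-- On `α` and the table `P`, the state of the system upon success is the posterior. -/
def Heralded.Updates {N b : ℕ} (A : Heralded (Fin N) N b) (P : Table N b)
    (α : Space (Fin N)) : Prop :=
  SystemIs (posterior P α) (A.succeeded P α)

/-- On input `v` and the table `P`, the final state of the system is `target` (whenever `A`
stops). -/
def Adaptive.Outputs {κ : Type} [Fintype κ] {N b : ℕ} (A : Adaptive κ N b) (P : Table N b)
    (v : Space κ) (target : Space (Fin N)) : Prop :=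
  ∀ t, SystemIs target (A.stopped P v t)

/-- `F N Γ` performs, for each dimension `N` and bound `Γ`, a heralded quantum Bayesian update of
an arbitrary (unknown) state with `O(1)` queries and success probability
`Ω(∑ₓ |αₓ|² P(E|x) / Γ)`. -/
structure IsUpdateAlgorithm (b : ℕ → ℕ) (F : ∀ N, ℝ → Heralded (Fin N) N (b N)) : Prop where
  queries_bounded : ∃ T : ℕ, ∀ N Γ, 0 < Γ → Γ ≤ 1 → (F N Γ).queries ≤ T
  updates : ∀ N Γ P α, Admissible Γ P α → (F N Γ).Updates P α
  success_bigOmega : ∃ c : ℝ, 0 < c ∧ ∃ N₀ : ℕ, ∀ N ≥ N₀, ∀ Γ P α, Admissible Γ P α →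
    c * (evidence P α / Γ) ≤ (F N Γ).successProb P α

/-- `G N Γ α` performs a heralded quantum Bayesian update with `O(1)` queries and success
probability `ω(∑ₓ |αₓ|² P(E|x) / Γ)`, as `N → ∞` and `∑ₓ |αₓ|² P(E|x) / Γ → 0`. The algorithm may
be tailored to the state `α`. -/
structure IsImprovedUpdateAlgorithm (b : ℕ → ℕ)
    (G : ∀ N, ℝ → Space (Fin N) → Heralded (Fin N) N (b N)) : Prop where
  queries_bounded : ∃ T : ℕ, ∀ N Γ α, 0 < Γ → Γ ≤ 1 → ‖α‖ = 1 → (G N Γ α).queries ≤ T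
  updates : ∀ N Γ P α, Admissible Γ P α → (G N Γ α).Updates P α
  success_littleOmega : ∀ K : ℝ, ∃ δ : ℝ, 0 < δ ∧ ∃ N₀ : ℕ, ∀ N ≥ N₀, ∀ Γ P α,
    Admissible Γ P α → evidence P α / Γ ≤ δ →
      K * (evidence P α / Γ) ≤ (G N Γ α).successProb P α

/-- `H N Γ a` turns the state that a failed run of `F N Γ` leaves behind back into the state to
which `F N Γ` was applied, with `o(√N / log N)` queries on average. That state may itself stem
from earlier uses of the oracle: `a P` is the state when the table is `P`. The algorithm may be
tailored to the function `a`, but learns about `P` only from its input and its queries. -/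
def IsUndoAlgorithm (b : ℕ → ℕ) (F : ∀ N, ℝ → Heralded (Fin N) N (b N))
    (H : ∀ N Γ, (Table N (b N) → Space (Fin N)) →
      Adaptive (Reg N (b N) ((F N Γ).w (F N Γ).queries)) N (b N)) : Prop :=
  ∃ q : ℕ → ℝ, q =o[atTop] (fun N => √(N : ℝ) / Real.log N) ∧
    ∀ N Γ P a, Admissible Γ P (a P) → (F N Γ).failed P (a P) ≠ 0 →
      (H N Γ a).Outputs P ((F N Γ).failedState P (a P)) (a P) ∧
      (H N Γ a).expectedQueries P ((F N Γ).failedState P (a P)) ≤ ENNReal.ofReal (q N)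

/-- `I N Γ α` performs a quantum Bayesian update (with certainty) with `o(√N)` queries on average,
for all oracles. The algorithm may be tailored to the state `α`. -/
def IsAverageUpdateAlgorithm (b : ℕ → ℕ)
    (I : ∀ N, ℝ → Space (Fin N) → Adaptive (Fin N) N (b N)) : Prop :=
  ∃ q : ℕ → ℝ, q =o[atTop] (fun N => √(N : ℝ)) ∧
    ∀ N Γ P α, Admissible Γ P α →
      (I N Γ α).Outputs P α (posterior P α) ∧
      (I N Γ α).expectedQueries P α ≤ ENNReal.ofReal (q N)

end QBayes

end

/-!
All three impossibility results come from tables with a single marked entry, with `Γ = 1`, and from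
the hybrid argument for unstructured search: marking `x` changes a run by at most twice the total
amplitude with which `x` is queried while nothing is marked (`Adaptive.hybrid`), and the squares
of these amplitudes add up, over all `x`, to at most the square of the number of queries
(`Adaptive.sum_visits_sq_le`). So for some `x` fewer than a small multiple of `√N` queries change
little.

An update of the uniform superposition produces the marked `|x⟩`. With `O(1)` queries this succeeds
with probability `O(1 / N) = O(q / Γ)`. An adaptive algorithm that makes `o(√N)` queries on average
stops, by Markov's inequality, within `η √N` queries with probability at least `1 - η`, and so
cannot produce `|x⟩` either.

For the undoing of failures, let `α = c|x₀⟩ + s|x⟩`, which depends on the table only through the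
marked entry `x`. As `F` makes `O(1)` queries, a failed run on `|x₀⟩` leaves almost the same state
whether or not `x` is marked, for most `x`. As `F` succeeds on `|x⟩` with probability at least a
constant `p`, the contribution of `s|x⟩` to the state after failure has norm at most `s √(1 - p)`.
Hence this state is within about `s √(1 - p) + s²` of one that is independent of `x`, the `s²` being
due to the normalisation (`Heralded.norm_failedState_twoLevel_sub_le`). The restored state `α` has
amplitude `s` at `x`, which is at distance about `s` from every state that is independent of `x`,
for most `x`. For a small constant `s` the gap between the two is a positive constant, and by the
hybrid argument bridging it takes `Ω(√N)` queries.
-/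

namespace QBayes

/-! ### Projections of the registers -/

section Projections

variable {ι : Type} [Fintype ι]

/-- The orthogonal projection onto the span of the basis vectors with labels in `s`. -/
noncomputable def proj (s : Set ι) : Space ι →ₗ[ℂ] Space ι where
  toFun ψ := open Classical in WithLp.toLp 2 fun i => if i ∈ s then ψ i else 0
  map_add' ψ φ := by
    ext i
    by_cases h : i ∈ s <;> simp [h]
  map_smul' c ψ := by
    ext i
    by_cases h : i ∈ s <;> simp [h]

theorem proj_apply_of_mem {s : Set ι} {i : ι} (h : i ∈ s) (ψ : Space ι) :
    proj s ψ i = ψ i := by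
  simp [proj, h]

theorem proj_apply_of_notMem {s : Set ι} {i : ι} (h : i ∉ s) (ψ : Space ι) :
    proj s ψ i = 0 := by
  simp [proj, h]

theorem norm_sq_proj_add_norm_sq_proj_compl (s : Set ι) (ψ : Space ι) :
    ‖proj s ψ‖ ^ 2 + ‖proj sᶜ ψ‖ ^ 2 = ‖ψ‖ ^ 2 := by
  simp only [EuclideanSpace.norm_sq_eq, ← Finset.sum_add_distrib]
  refine Finset.sum_congr rfl fun i _ => ?_
  by_cases h : i ∈ s
  · rw [proj_apply_of_mem h, proj_apply_of_notMem (by simpa using h)]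
    simp
  · rw [proj_apply_of_notMem h, proj_apply_of_mem (by simpa using h)]
    simp

theorem norm_proj_le (s : Set ι) (ψ : Space ι) : ‖proj s ψ‖ ≤ ‖ψ‖ := by
  have h := norm_sq_proj_add_norm_sq_proj_compl s ψ
  exact (sq_le_sq₀ (norm_nonneg _) (norm_nonneg _)).1 (by nlinarith [sq_nonneg ‖proj sᶜ ψ‖])

end Projections

variable {N b w : ℕ}

/-- The projection onto the states whose system register is `|x⟩`. -/
noncomputable def sysProj (x : Fin N) : Space (Reg N b w) →ₗ[ℂ] Space (Reg N b w) :=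
  proj {r | r.1 = x}

theorem component_eq_proj (S : Set (Fin w)) (ψ : Space (Reg N b w)) :
    component S ψ = proj {r | r.2.2 ∈ S} ψ := rfl

theorem component_sub (S : Set (Fin w)) (ψ φ : Space (Reg N b w)) :
    component S (ψ - φ) = component S ψ - component S φ := by
  simp only [component_eq_proj, map_sub]

theorem component_add (S : Set (Fin w)) (ψ φ : Space (Reg N b w)) :
    component S (ψ + φ) = component S ψ + component S φ := by
  simp only [component_eq_proj, map_add]

theorem component_smul (S : Set (Fin w)) (c : ℂ) (ψ : Space (Reg N b w)) :
    component S (c • ψ) = c • component S ψ := by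
  simp only [component_eq_proj, map_smul]

theorem norm_component_le (S : Set (Fin w)) (ψ : Space (Reg N b w)) :
    ‖component S ψ‖ ≤ ‖ψ‖ := norm_proj_le _ _

theorem norm_sq_component_add (S : Set (Fin w)) (ψ : Space (Reg N b w)) :
    ‖component S ψ‖ ^ 2 + ‖component Sᶜ ψ‖ ^ 2 = ‖ψ‖ ^ 2 :=
  norm_sq_proj_add_norm_sq_proj_compl _ _

theorem norm_sysProj_le (x : Fin N) (ψ : Space (Reg N b w)) : ‖sysProj x ψ‖ ≤ ‖ψ‖ :=
  norm_proj_le _ _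

theorem norm_sq_sysProj (x : Fin N) (ψ : Space (Reg N b w)) :
    ‖sysProj x ψ‖ ^ 2 = ∑ r, ‖ψ (x, r)‖ ^ 2 := by
  rw [EuclideanSpace.norm_sq_eq, Fintype.sum_prod_type, Finset.sum_eq_single x]
  · refine Finset.sum_congr rfl fun r _ => ?_
    rw [sysProj, proj_apply_of_mem (by simp)]
  · intro z _ hz
    refine Finset.sum_eq_zero fun r _ => ?_
    rw [sysProj, proj_apply_of_notMem (by simpa using hz)]
    simp
  · simp

theorem sum_norm_sq_sysProj (ψ : Space (Reg N b w)) :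
    ∑ x, ‖sysProj x ψ‖ ^ 2 = ‖ψ‖ ^ 2 := by
  simp only [norm_sq_sysProj]
  rw [EuclideanSpace.norm_sq_eq, Fintype.sum_prod_type]

theorem SystemIs.norm_sq_sysProj {target : Space (Fin N)} {ψ : Space (Reg N b w)}
    (h : SystemIs target ψ) (ht : ‖target‖ = 1) (x : Fin N) :
    ‖sysProj x ψ‖ ^ 2 = ‖target x‖ ^ 2 * ‖ψ‖ ^ 2 := by
  obtain ⟨φ, hφ⟩ := h
  have h1 : ∀ z, ‖sysProj z ψ‖ ^ 2 = ‖target z‖ ^ 2 * ∑ r, ‖φ r‖ ^ 2 := fun z => by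
    simp only [QBayes.norm_sq_sysProj, hφ, norm_mul, mul_pow, Finset.mul_sum]
  rw [← sum_norm_sq_sysProj ψ, h1 x]
  simp only [h1, ← Finset.sum_mul, ← EuclideanSpace.norm_sq_eq, ht]
  ring

theorem SystemIs.sysProj_eq {target : Space (Fin N)} {ψ : Space (Reg N b w)}
    (h : SystemIs target ψ) {x : Fin N} (hx : ∀ z ≠ x, target z = 0) : sysProj x ψ = ψ := by
  obtain ⟨φ, hφ⟩ := h
  ext ⟨z, r⟩
  by_cases hz : z = x
  · exact proj_apply_of_mem (by simpa using hz) _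
  · rw [hφ, hx z hz, zero_mul]
    exact proj_apply_of_notMem (by simpa using hz) _

/-! ### Tables with one marked entry -/

/-- The table of the likelihood function that vanishes identically. -/
def nullTable (N b : ℕ) : Table N b := fun _ _ => false

/-- The table of the likelihood function with value `1` at `x` and `0` elsewhere: only the leading
bit, which has weight `2⁰`, is used. -/
def markTable {N b : ℕ} (x : Fin N) : Table N b := fun z i => decide (z = x ∧ (i : ℕ) = 0)

theorem markTable_of_ne {x z : Fin N} (h : z ≠ x) :
    (markTable x : Table N b) z = nullTable N b z := by
  funext i
  simp [markTable, nullTable, h]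

theorem likelihood_markTable (hb : 1 ≤ b) (x z : Fin N) :
    likelihood (markTable x : Table N b) z = if z = x then 1 else 0 := by
  obtain ⟨b, rfl⟩ := Nat.exists_eq_add_of_le' hb
  by_cases h : z = x
  · simp [likelihood, bitValue, markTable, h]
  · simp [likelihood, bitValue, markTable, h]

theorem evidence_markTable (hb : 1 ≤ b) (x : Fin N) (α : Space (Fin N)) :
    evidence (markTable x : Table N b) α = ‖α x‖ ^ 2 := by
  simp [evidence, likelihood_markTable hb]

theorem posterior_markTable (hb : 1 ≤ b) (x : Fin N) (α : Space (Fin N)) :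
    ∀ z ≠ x, posterior (markTable x : Table N b) α z = 0 := by
  intro z hz
  simp [posterior, likelihood_markTable hb, hz]

theorem admissible_markTable (hb : 1 ≤ b) {x : Fin N} {α : Space (Fin N)} (hα : ‖α‖ = 1)
    (hx : α x ≠ 0) : Admissible 1 (markTable x : Table N b) α where
  bound_pos := one_pos
  bound_le_one := le_rfl
  likelihood_le z := by
    rw [likelihood_markTable hb]
    split_ifs <;> norm_num
  unit := hα
  evidence_pos := by
    rw [evidence_markTable hb]
    positivity

/-- If two tables agree away from `x`, then one query tells them apart only on the part of the
state whose system register is `|x⟩`. -/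
theorem norm_oracle_sub_oracle_le {P Q : Table N b} {x : Fin N} (h : ∀ z ≠ x, P z = Q z)
    (ψ : Space (Reg N b w)) : ‖oracle P w ψ - oracle Q w ψ‖ ≤ 2 * ‖sysProj x ψ‖ := by
  have key : oracle P w ψ - oracle Q w ψ =
      oracle P w (sysProj x ψ) - oracle Q w (sysProj x ψ) := by
    ext ⟨z, y, s⟩
    change ψ (z, bxor y (P z), s) - ψ (z, bxor y (Q z), s) =
      sysProj x ψ (z, bxor y (P z), s) - sysProj x ψ (z, bxor y (Q z), s)
    by_cases hz : z = x
    · rw [sysProj, proj_apply_of_mem (by simpa using hz), proj_apply_of_mem (by simpa using hz)]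
    · rw [h z hz, sub_self, sub_self]
  rw [key]
  refine (norm_sub_le _ _).trans (le_of_eq ?_)
  rw [LinearIsometryEquiv.norm_map, LinearIsometryEquiv.norm_map, two_mul]

/-! ### Linearity and conservation of probability -/

section Runs

variable {κ : Type} [Fintype κ]

theorem Circuit.run_add (A : Circuit κ N b) (P : Table N b) (u v : Space κ) (t : ℕ) :
    A.run P (u + v) t = A.run P u t + A.run P v t := by
  induction t with
  | zero => simp [Circuit.run]
  | succ t ih => simp [Circuit.run, ih]

theorem Circuit.run_smul (A : Circuit κ N b) (P : Table N b) (c : ℂ) (v : Space κ) (t : ℕ) :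
    A.run P (c • v) t = c • A.run P v t := by
  induction t with
  | zero => simp [Circuit.run]
  | succ t ih => simp [Circuit.run, ih]

theorem Circuit.norm_run (A : Circuit κ N b) (P : Table N b) (v : Space κ) (t : ℕ) :
    ‖A.run P v t‖ = ‖v‖ := by
  induction t with
  | zero => simp [Circuit.run]
  | succ t ih => simp [Circuit.run, ih]

theorem Heralded.norm_sq_succeeded_add (A : Heralded κ N b) (P : Table N b) (v : Space κ) :
    ‖A.succeeded P v‖ ^ 2 + ‖A.failed P v‖ ^ 2 = ‖v‖ ^ 2 := by
  rw [Heralded.succeeded, Heralded.failed, norm_sq_component_add, Circuit.norm_run]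

theorem Adaptive.norm_branch_succ (A : Adaptive κ N b) (P : Table N b) (v : Space κ) (t : ℕ) :
    ‖A.branch P v (t + 1)‖ = ‖component (A.halt t)ᶜ (A.branch P v t)‖ := by
  simp [Adaptive.branch]

/-- The branches that stop before the `T`-th query and the branch that makes it share the whole
probability. -/
theorem Adaptive.sum_norm_sq_stopped_add (A : Adaptive κ N b) (P : Table N b) (v : Space κ)
    (T : ℕ) :
    ∑ t ∈ Finset.range T, ‖A.stopped P v t‖ ^ 2 + ‖A.branch P v T‖ ^ 2 = ‖v‖ ^ 2 := by
  induction T with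
  | zero => simp [Adaptive.branch]
  | succ T ih =>
    rw [Finset.sum_range_succ, add_assoc, Adaptive.norm_branch_succ, Adaptive.stopped,
      norm_sq_component_add, ih]

theorem Adaptive.norm_branch_antitone (A : Adaptive κ N b) (P : Table N b) (v : Space κ) :
    Antitone fun t => ‖A.branch P v t‖ :=
  antitone_nat_of_succ_le fun t => by
    rw [Adaptive.norm_branch_succ]
    exact norm_component_le _ _

/-- Markov's inequality for the number of queries. -/
theorem Adaptive.mul_norm_sq_branch_le (A : Adaptive κ N b) (P : Table N b) (v : Space κ)
    {h : ℝ} (hA : A.expectedQueries P v ≤ ENNReal.ofReal h) {T : ℕ} (hh : 0 ≤ h) :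
    T * ‖A.branch P v T‖ ^ 2 ≤ h := by
  have h1 : ∑ t ∈ Finset.range T,
      ENNReal.ofReal (‖component (A.halt t)ᶜ (A.branch P v t)‖ ^ 2) ≤ ENNReal.ofReal h :=
    (ENNReal.sum_le_tsum _).trans hA
  rw [← ENNReal.ofReal_sum_of_nonneg (fun _ _ => by positivity),
    ENNReal.ofReal_le_ofReal_iff hh] at h1
  refine le_trans ?_ h1
  have h2 : ∀ t ∈ Finset.range T,
      ‖A.branch P v T‖ ^ 2 ≤ ‖component (A.halt t)ᶜ (A.branch P v t)‖ ^ 2 := fun t ht => by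
    rw [← Adaptive.norm_branch_succ]
    exact pow_le_pow_left₀ (norm_nonneg _)
      (A.norm_branch_antitone P v (Nat.succ_le_of_lt (Finset.mem_range.1 ht))) 2
  simpa using Finset.sum_le_sum h2

/-! ### The hybrid argument -/

/-- The total amplitude with which the first `T` queries of `A`, run on the null table, ask for
the entry `x`. -/
noncomputable def Adaptive.visits (A : Adaptive κ N b) (v : Space κ) (T : ℕ) (x : Fin N) : ℝ :=
  ∑ t ∈ Finset.range T,
    ‖sysProj x (component (A.halt t)ᶜ (A.branch (nullTable N b) v t))‖

/-- The amplitude with which `A`, run on the null table, stops before the `T`-th query with the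
system register in the state `|x⟩`. -/
noncomputable def Adaptive.hits (A : Adaptive κ N b) (v : Space κ) (T : ℕ) (x : Fin N) : ℝ :=
  √(∑ t ∈ Finset.range T, ‖sysProj x (A.stopped (nullTable N b) v t)‖ ^ 2)

theorem Adaptive.sum_visits_sq_le (A : Adaptive κ N b) (v : Space κ) (T : ℕ) :
    ∑ x, A.visits v T x ^ 2 ≤ T ^ 2 * ‖v‖ ^ 2 := by
  calc ∑ x, A.visits v T x ^ 2
      ≤ ∑ x, T * ∑ t ∈ Finset.range T,
          ‖sysProj x (component (A.halt t)ᶜ (A.branch (nullTable N b) v t))‖ ^ 2 := by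
        refine Finset.sum_le_sum fun x _ => ?_
        simpa [Adaptive.visits] using sq_sum_le_card_mul_sum_sq (s := Finset.range T)
          (f := fun t => ‖sysProj x (component (A.halt t)ᶜ (A.branch (nullTable N b) v t))‖)
    _ = T * ∑ t ∈ Finset.range T, ‖A.branch (nullTable N b) v (t + 1)‖ ^ 2 := by
        rw [← Finset.mul_sum, Finset.sum_comm]
        simp only [sum_norm_sq_sysProj, Adaptive.norm_branch_succ]
    _ ≤ T * ∑ t ∈ Finset.range T, ‖v‖ ^ 2 := by
        gcongr with t
        simpa [Adaptive.branch] using A.norm_branch_antitone (nullTable N b) v (Nat.zero_le (t + 1))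
    _ = T ^ 2 * ‖v‖ ^ 2 := by
        simp
        ring

theorem Adaptive.sum_hits_sq_le (A : Adaptive κ N b) (v : Space κ) (T : ℕ) :
    ∑ x, A.hits v T x ^ 2 ≤ ‖v‖ ^ 2 := by
  have h : ∀ x, A.hits v T x ^ 2 =
      ∑ t ∈ Finset.range T, ‖sysProj x (A.stopped (nullTable N b) v t)‖ ^ 2 := fun x =>
    Real.sq_sqrt (Finset.sum_nonneg fun _ _ => by positivity)
  simp only [h]
  rw [Finset.sum_comm]
  simp only [sum_norm_sq_sysProj]
  have := A.sum_norm_sq_stopped_add (nullTable N b) v T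
  nlinarith [sq_nonneg ‖A.branch (nullTable N b) v T‖]

theorem sqrt_add_add_sq_le {a u v : ℝ} (ha : 0 ≤ a) (hv : 0 ≤ v) :
    √(a + (u + v) ^ 2) ≤ √(a + u ^ 2) + v := by
  have h0 : 0 ≤ a + u ^ 2 := by positivity
  have h1 : u ≤ √(a + u ^ 2) := Real.le_sqrt_of_sq_le (by linarith)
  refine Real.sqrt_le_iff.2 ⟨by positivity, ?_⟩
  nlinarith [Real.sq_sqrt h0, mul_le_mul_of_nonneg_right h1 hv]

/-- The hybrid argument: marking `x` changes the final states by no more than twice the amplitude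
with which `x` is asked for while nothing is marked. The distance is the Hilbert space norm on
the direct sum of all branches, so that the measurements cause no loss. -/
theorem Adaptive.hybrid (A : Adaptive κ N b) (x : Fin N) (u v : Space κ) (T : ℕ) :
    √(∑ t ∈ Finset.range T,
        ‖A.stopped (markTable x) u t - A.stopped (nullTable N b) v t‖ ^ 2 +
      ‖A.branch (markTable x) u T - A.branch (nullTable N b) v T‖ ^ 2) ≤
      ‖u - v‖ + 2 * A.visits v T x := by
  induction T with
  | zero => simp [Adaptive.branch, Adaptive.visits, ← map_sub]
  | succ T ih =>
    set S := ∑ t ∈ Finset.range T,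
        ‖A.stopped (markTable x) u t - A.stopped (nullTable N b) v t‖ ^ 2
    set p := A.branch (markTable x) u T
    set q := A.branch (nullTable N b) v T
    set c := component (A.halt T)ᶜ q
    have hS : 0 ≤ S := Finset.sum_nonneg fun _ _ => by positivity
    have hfinal : A.stopped (markTable x) u T - A.stopped (nullTable N b) v T =
        component (A.halt T) (p - q) := (component_sub _ _ _).symm
    have hstep : ‖A.branch (markTable x) u (T + 1) - A.branch (nullTable N b) v (T + 1)‖ ≤
        ‖component (A.halt T)ᶜ (p - q)‖ + 2 * ‖sysProj x c‖ := by
      rw [Adaptive.branch, Adaptive.branch, ← map_sub, LinearIsometry.norm_map]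
      calc _ = ‖oracle (markTable x) _ (component (A.halt T)ᶜ p - c) +
              (oracle (markTable x) _ c - oracle (nullTable N b) _ c)‖ := by
            rw [map_sub]
            congr 1
            abel
        _ ≤ _ := by
            refine (norm_add_le _ _).trans (add_le_add ?_ ?_)
            · rw [LinearIsometryEquiv.norm_map, component_sub]
            · exact norm_oracle_sub_oracle_le (fun z hz => markTable_of_ne hz) _
    have hvis : A.visits v (T + 1) x = A.visits v T x + ‖sysProj x c‖ :=
      Finset.sum_range_succ _ _
    rw [Finset.sum_range_succ, hfinal, hvis]
    calc _ ≤ √(S + ‖component (A.halt T) (p - q)‖ ^ 2 +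
            (‖component (A.halt T)ᶜ (p - q)‖ + 2 * ‖sysProj x c‖) ^ 2) := by
          gcongr
      _ ≤ √(S + ‖component (A.halt T) (p - q)‖ ^ 2 + ‖component (A.halt T)ᶜ (p - q)‖ ^ 2) +
            2 * ‖sysProj x c‖ := sqrt_add_add_sq_le (by positivity) (by positivity)
      _ = √(S + ‖p - q‖ ^ 2) + 2 * ‖sysProj x c‖ := by
          rw [add_assoc, norm_sq_component_add]
      _ ≤ _ := by linarith

theorem sqrt_sum_add_sq_le (T : ℕ) (f g : ℕ → ℝ) :
    √(∑ t ∈ Finset.range T, (f t + g t) ^ 2) ≤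
      √(∑ t ∈ Finset.range T, f t ^ 2) + √(∑ t ∈ Finset.range T, g t ^ 2) := by
  have h := norm_add_le (WithLp.toLp 2 fun i : Fin T => f i) (WithLp.toLp 2 fun i : Fin T => g i)
  simpa [EuclideanSpace.norm_eq, Finset.sum_range] using h

/-- The amplitude with which `A` stops before the `T`-th query and finds the marked entry. -/
theorem Adaptive.sqrt_sum_norm_sq_sysProj_stopped_le (A : Adaptive κ N b) (x : Fin N)
    (u v : Space κ) (T : ℕ) :
    √(∑ t ∈ Finset.range T, ‖sysProj x (A.stopped (markTable x) u t)‖ ^ 2) ≤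
      ‖u - v‖ + 2 * A.visits v T x + A.hits v T x := by
  have h1 : √(∑ t ∈ Finset.range T,
      ‖A.stopped (markTable x) u t - A.stopped (nullTable N b) v t‖ ^ 2) ≤
      ‖u - v‖ + 2 * A.visits v T x :=
    (Real.sqrt_le_sqrt (le_add_of_nonneg_right (sq_nonneg _))).trans (A.hybrid x u v T)
  refine le_trans ?_ (add_le_add_left h1 _)
  refine le_trans (Real.sqrt_le_sqrt (Finset.sum_le_sum fun t _ => ?_)) (sqrt_sum_add_sq_le T _ _)
  refine pow_le_pow_left₀ (norm_nonneg _) ?_ 2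
  calc ‖sysProj x (A.stopped (markTable x) u t)‖
      = ‖sysProj x (A.stopped (markTable x) u t - A.stopped (nullTable N b) v t) +
          sysProj x (A.stopped (nullTable N b) v t)‖ := by rw [map_sub, sub_add_cancel]
    _ ≤ _ := (norm_add_le _ _).trans (add_le_add_left (norm_sysProj_le _ _) _)

/-- A circuit, seen as an algorithm that never stops. -/
def Circuit.neverHalting (A : Circuit κ N b) : Adaptive κ N b where
  toCircuit := A
  halt _ := ∅

theorem Circuit.branch_neverHalting (A : Circuit κ N b) (P : Table N b) (v : Space κ) (t : ℕ) :
    A.neverHalting.branch P v t = A.run P v t := by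
  induction t with
  | zero => rfl
  | succ t ih =>
    rw [Adaptive.branch, ih, Circuit.run]
    congr 2
    ext r
    exact if_pos (Set.notMem_empty _)

theorem Circuit.norm_run_sub_run_le (A : Circuit κ N b) (x : Fin N) (v : Space κ) (T : ℕ) :
    ‖A.run (markTable x) v T - A.run (nullTable N b) v T‖ ≤
      2 * A.neverHalting.visits v T x := by
  have h := A.neverHalting.hybrid x v v T
  rw [sub_self, norm_zero, zero_add] at h
  refine le_trans (Real.le_sqrt_of_sq_le ?_) h
  rw [Circuit.branch_neverHalting, Circuit.branch_neverHalting]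
  exact le_add_of_nonneg_left (Finset.sum_nonneg fun _ _ => by positivity)

/-- The amplitude with which a heralded algorithm succeeds and finds the marked entry. -/
theorem Heralded.norm_sysProj_succeeded_le (A : Heralded κ N b) (x : Fin N) (v : Space κ) :
    ‖sysProj x (A.succeeded (markTable x) v)‖ ≤
      2 * A.neverHalting.visits v A.queries x +
        ‖sysProj x (A.run (nullTable N b) v A.queries)‖ := by
  have hcomm : ∀ ψ : Space (Reg N b (A.w A.queries)),
      sysProj x (component A.success ψ) = component A.success (sysProj x ψ) := fun ψ => by
    ext r
    by_cases h1 : r.1 = x <;> by_cases h2 : r.2.2 ∈ A.success <;>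
      simp [sysProj, proj, component, h1, h2]
  rw [Heralded.succeeded, hcomm]
  refine (norm_component_le _ _).trans ?_
  calc ‖sysProj x (A.run (markTable x) v A.queries)‖
      = ‖sysProj x (A.run (markTable x) v A.queries - A.run (nullTable N b) v A.queries) +
          sysProj x (A.run (nullTable N b) v A.queries)‖ := by rw [map_sub, sub_add_cancel]
    _ ≤ _ := (norm_add_le _ _).trans (add_le_add_left
        ((norm_sysProj_le _ _).trans (A.norm_run_sub_run_le x v _)) _)

end Runs

/-! ### Choice of the marked entry and of the truncation -/

theorem exists_ne_mul_le_of_sum_le {N : ℕ} (hN : 2 ≤ N) {f : Fin N → ℝ} {K : ℝ}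
    (hf : ∀ x, 0 ≤ f x) (hK : ∑ x, f x ≤ K) (x₀ : Fin N) : ∃ x ≠ x₀, N * f x ≤ 2 * K := by
  by_contra! h
  have hN' : (2 : ℝ) ≤ N := by exact_mod_cast hN
  have h1 : ∑ x ∈ Finset.univ.erase x₀, N * f x ≤ N * K := by
    rw [← Finset.mul_sum]
    exact mul_le_mul_of_nonneg_left ((Finset.sum_le_sum_of_subset_of_nonneg
      (Finset.erase_subset _ _) fun x _ _ => hf x).trans hK) (by linarith)
  have hcard : (Finset.univ.erase x₀ : Finset (Fin N)).card = N - 1 := by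
    simp [Finset.card_erase_of_mem]
  have h2 : ∑ _x ∈ Finset.univ.erase x₀, 2 * K < ∑ x ∈ Finset.univ.erase x₀, N * f x := by
    refine Finset.sum_lt_sum_of_nonempty (Finset.card_pos.1 (by omega)) fun x hx => ?_
    exact h x (Finset.ne_of_mem_erase hx)
  rw [Finset.sum_const, hcard, nsmul_eq_mul, Nat.cast_sub (by omega)] at h2
  have hK0 : 0 ≤ K := (Finset.sum_nonneg fun x _ => hf x).trans hK
  push_cast at h2
  nlinarith

/-- For `h = o(√N)` there are truncations `T ≈ η √N` that are long compared with `h` but too short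
to search `N` entries. -/
theorem eventually_exists_truncation {h : ℕ → ℝ}
    (hh : h =o[atTop] (fun N => √(N : ℝ))) (C : ℝ) {η : ℝ} (hη : 0 < η) :
    ∀ᶠ N : ℕ in atTop, ∃ T : ℕ, 0 < T ∧ |h N| ≤ η * T ∧ 2 * (T ^ 2 + C) ≤ 9 * η ^ 2 * N := by
  have hlarge : ∀ᶠ N : ℕ in atTop, (4 + 2 * C) / (5 * η ^ 2) ≤ (N : ℝ) :=
    tendsto_natCast_atTop_atTop.eventually_ge_atTop _
  filter_upwards [hh.bound (show 0 < η ^ 2 by positivity), hlarge,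
    eventually_ge_atTop 1] with N h1 h2 h3
  have hN : (1 : ℝ) ≤ N := by exact_mod_cast h3
  have hs : 0 < √(N : ℝ) := Real.sqrt_pos.2 (by linarith)
  have hsq : √(N : ℝ) ^ 2 = N := Real.sq_sqrt (by linarith)
  rw [Real.norm_eq_abs, Real.norm_eq_abs, abs_of_pos hs] at h1
  have hlow := Nat.le_ceil (η * √(N : ℝ))
  have hupp := (Nat.ceil_lt_add_one (show 0 ≤ η * √(N : ℝ) by positivity)).le
  refine ⟨⌈η * √(N : ℝ)⌉₊, Nat.ceil_pos.2 (by positivity), ?_, ?_⟩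
  · nlinarith
  · rw [div_le_iff₀ (by positivity)] at h2
    have h4 : (⌈η * √(N : ℝ)⌉₊ : ℝ) ^ 2 ≤ (η * √(N : ℝ) + 1) ^ 2 :=
      pow_le_pow_left₀ (by positivity) hupp 2
    have h5 : (η * √(N : ℝ)) ^ 2 = η ^ 2 * N := by rw [mul_pow, hsq]
    nlinarith [sq_nonneg (η * √(N : ℝ) - 1)]

/-- Within `T ≥ h / η` queries an algorithm that makes `h` queries on average stops with
probability at least `1 - η`. -/
theorem Adaptive.one_sub_le_sum_norm_sq_stopped {κ : Type} [Fintype κ] {N b : ℕ}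
    (A : Adaptive κ N b) (P : Table N b) {v : Space κ} (hv : ‖v‖ = 1) {h η : ℝ} {T : ℕ}
    (hA : A.expectedQueries P v ≤ ENNReal.ofReal h) (hT : 0 < T) (hη : |h| ≤ η * T) :
    1 - η ≤ ∑ t ∈ Finset.range T, ‖A.stopped P v t‖ ^ 2 := by
  have h1 := A.mul_norm_sq_branch_le P v (T := T)
    (hA.trans (ENNReal.ofReal_le_ofReal (le_abs_self h))) (abs_nonneg h)
  have h2 := A.sum_norm_sq_stopped_add P v T
  have hT' : (0 : ℝ) < T := by exact_mod_cast hT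
  have h3 : ‖A.branch P v T‖ ^ 2 ≤ η := by
    refine le_of_mul_le_mul_left ?_ hT'
    linarith
  rw [hv] at h2
  linarith

/-! ### The uniform superposition -/

/-- The uniform superposition of all `|x⟩`. -/
noncomputable def uniformState (N : ℕ) : Space (Fin N) :=
  WithLp.toLp 2 fun _ => (((√(N : ℝ))⁻¹ : ℝ) : ℂ)

theorem norm_sq_uniformState_apply {N : ℕ} (x : Fin N) :
    ‖uniformState N x‖ ^ 2 = (N : ℝ)⁻¹ := by
  rw [uniformState, PiLp.toLp_apply, Complex.norm_real, Real.norm_eq_abs, sq_abs, inv_pow,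
    Real.sq_sqrt (Nat.cast_nonneg N)]

theorem norm_uniformState {N : ℕ} (hN : 0 < N) : ‖uniformState N‖ = 1 := by
  have hN' : (N : ℝ) ≠ 0 := by exact_mod_cast hN.ne'
  have h : ‖uniformState N‖ ^ 2 = 1 := by
    rw [EuclideanSpace.norm_sq_eq]
    simp [norm_sq_uniformState_apply, hN']
  exact (pow_eq_one_iff_of_nonneg (norm_nonneg _) two_ne_zero).1 h

theorem admissible_uniformState {N b : ℕ} (hb : 1 ≤ b) (x : Fin N) :
    Admissible 1 (markTable x : Table N b) (uniformState N) := by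
  have hN : 0 < N := x.pos
  refine admissible_markTable hb (norm_uniformState hN) fun h => ?_
  have h1 := norm_sq_uniformState_apply x
  rw [h, norm_zero] at h1
  have hN' : (0 : ℝ) < (N : ℝ)⁻¹ := by positivity
  linarith

/-- With a constant number of queries, a marked entry is found with probability `O(1 / N)`. -/
theorem not_isImprovedUpdateAlgorithm {b : ℕ → ℕ} (hb : ∀ N, 1 ≤ b N)
    (G : ∀ N, ℝ → Space (Fin N) → Heralded (Fin N) N (b N)) :
    ¬ IsImprovedUpdateAlgorithm b G := by
  intro hG
  obtain ⟨T, hT⟩ := hG.queries_bounded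
  obtain ⟨δ, hδ, N₀, hN₀⟩ := hG.success_littleOmega (10 * (T ^ 2 + 1) + 1)
  obtain ⟨N, hNδ, hNN₀, hN2⟩ := ((tendsto_inv_atTop_nhds_zero_nat (𝕜 := ℝ)).eventually_le_const hδ
    |>.and ((eventually_ge_atTop N₀).and (eventually_ge_atTop 2))).exists
  have hN : (0 : ℝ) < N := by exact_mod_cast (by omega : 0 < N)
  have hu := norm_uniformState (N := N) (by omega)
  set A := G N 1 (uniformState N)
  set v := uniformState N
  have hAT : (A.queries : ℝ) ≤ T := by exact_mod_cast hT N 1 v one_pos le_rfl hu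
  have hsum : ∑ x, (A.neverHalting.visits v A.queries x ^ 2 +
      ‖sysProj x (A.run (nullTable N (b N)) v A.queries)‖ ^ 2) ≤ T ^ 2 + 1 := by
    rw [Finset.sum_add_distrib, sum_norm_sq_sysProj, Circuit.norm_run, hu, one_pow]
    have h1 := A.neverHalting.sum_visits_sq_le v A.queries
    rw [hu, one_pow, mul_one] at h1
    have h2 : (A.queries : ℝ) ^ 2 ≤ T ^ 2 := pow_le_pow_left₀ (Nat.cast_nonneg _) hAT 2
    linarith
  obtain ⟨x, -, hx⟩ := exists_ne_mul_le_of_sum_le hN2 (fun x => by positivity) hsum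
    ⟨0, by omega⟩
  have hadm := admissible_uniformState (b := b N) (hb N) x
  have hev : evidence (markTable x : Table N (b N)) v / 1 = (N : ℝ)⁻¹ := by
    rw [evidence_markTable (hb N), norm_sq_uniformState_apply, div_one]
  have h1 := hN₀ N hNN₀ 1 _ _ hadm (hev ▸ hNδ)
  rw [hev, Heralded.successProb,
    ← (hG.updates N 1 _ _ hadm).sysProj_eq (posterior_markTable (hb N) x v)] at h1
  have h2 := A.norm_sysProj_succeeded_le x v
  set g := A.neverHalting.visits v A.queries x
  set e := ‖sysProj x (A.run (nullTable N (b N)) v A.queries)‖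
  have h3 : ‖sysProj x (A.succeeded (markTable x) v)‖ ^ 2 ≤ (2 * g + e) ^ 2 :=
    pow_le_pow_left₀ (norm_nonneg _) h2 2
  have h4 : 10 * ((T : ℝ) ^ 2 + 1) + 1 ≤ N * (2 * g + e) ^ 2 := by
    have := mul_le_mul_of_nonneg_left (h1.trans h3) hN.le
    rwa [mul_comm (N : ℝ), mul_assoc, inv_mul_cancel₀ hN.ne', mul_one] at this
  have h5 : (N : ℝ) * (2 * g + e) ^ 2 ≤ N * (5 * (g ^ 2 + e ^ 2)) := by
    gcongr
    nlinarith [sq_nonneg (g - 2 * e)]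
  linarith

/-- An update of the uniform superposition finds a marked entry. -/
theorem not_isAverageUpdateAlgorithm {b : ℕ → ℕ} (hb : ∀ N, 1 ≤ b N)
    (I : ∀ N, ℝ → Space (Fin N) → Adaptive (Fin N) N (b N)) :
    ¬ IsAverageUpdateAlgorithm b I := by
  rintro ⟨q, hq, hI⟩
  obtain ⟨N, ⟨T, hT0, hqT, hT⟩, hN2⟩ := ((eventually_exists_truncation hq 1
    (show (0 : ℝ) < 1 / 20 by norm_num)).and (eventually_ge_atTop 2)).exists
  have hN : (0 : ℝ) < N := by exact_mod_cast (by omega : 0 < N)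
  have hu := norm_uniformState (N := N) (by omega)
  set A := I N 1 (uniformState N)
  set v := uniformState N
  have hsum : ∑ x, (A.visits v T x ^ 2 + A.hits v T x ^ 2) ≤ T ^ 2 + 1 := by
    rw [Finset.sum_add_distrib]
    have h1 := A.sum_visits_sq_le v T
    have h2 := A.sum_hits_sq_le v T
    rw [hu] at h1 h2
    linarith
  obtain ⟨x, -, hx⟩ := exists_ne_mul_le_of_sum_le hN2 (fun x => by positivity) hsum
    ⟨0, by omega⟩
  obtain ⟨hout, hexp⟩ := hI N 1 _ _ (admissible_uniformState (b := b N) (hb N) x)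
  have h1 := A.sqrt_sum_norm_sq_sysProj_stopped_le x v v T
  have hst : ∀ t, sysProj x (A.stopped (markTable x) v t) = A.stopped (markTable x) v t :=
    fun t => (hout t).sysProj_eq (posterior_markTable (hb N) x v)
  simp only [hst, sub_self, norm_zero, zero_add] at h1
  have h2 := A.one_sub_le_sum_norm_sq_stopped (markTable x) hu hexp hT0 hqT
  have h3 : A.visits v T x ^ 2 + A.hits v T x ^ 2 ≤ 9 * (1 / 20) ^ 2 :=
    le_of_mul_le_mul_left (by linarith) hN
  have h4 := Real.sqrt_le_iff.1 h1
  nlinarith [sq_nonneg (A.visits v T x - 2 * A.hits v T x)]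

/-! ### Undoing a failed update -/

/-- The state `c|x₀⟩ + s|x⟩`. -/
noncomputable def twoLevel {N : ℕ} (x₀ x : Fin N) (c s : ℝ) : Space (Fin N) :=
  (c : ℂ) • EuclideanSpace.single x₀ 1 + (s : ℂ) • EuclideanSpace.single x 1

theorem norm_twoLevel {N : ℕ} {x₀ x : Fin N} (h : x ≠ x₀) {c s : ℝ} (hcs : c ^ 2 + s ^ 2 = 1) :
    ‖twoLevel x₀ x c s‖ = 1 := by
  have h1 : ‖twoLevel x₀ x c s‖ ^ 2 = 1 := by
    have h0 : inner ℂ ((c : ℂ) • EuclideanSpace.single x₀ (1 : ℂ))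
        ((s : ℂ) • EuclideanSpace.single x (1 : ℂ)) = 0 := by
      rw [inner_smul_left, inner_smul_right, EuclideanSpace.inner_single_left]
      simp [h.symm]
    rw [twoLevel, @norm_add_sq ℂ, h0]
    simp [norm_smul, hcs]
  exact (pow_eq_one_iff_of_nonneg (norm_nonneg _) two_ne_zero).1 h1

theorem twoLevel_apply_right {N : ℕ} {x₀ x : Fin N} (h : x ≠ x₀) (c s : ℝ) :
    twoLevel x₀ x c s x = s := by
  simp [twoLevel, h]

/-- A state that depends on the oracle: the amplitude `c` at the label `0`, and `s` times the
likelihood at the other labels. On a table with one marked entry it is `twoLevel`. -/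
noncomputable def tiltedState {N b : ℕ} (c s : ℝ) (P : Table N b) : Space (Fin N) :=
  WithLp.toLp 2 fun z => if (z : ℕ) = 0 then (c : ℂ) else ((s * likelihood P z : ℝ) : ℂ)

theorem tiltedState_markTable {N b : ℕ} (hb : 1 ≤ b) {x₀ x : Fin N} (h₀ : (x₀ : ℕ) = 0)
    (h : x ≠ x₀) (c s : ℝ) :
    tiltedState c s (markTable x : Table N b) = twoLevel x₀ x c s := by
  ext z
  have hz : (z : ℕ) = 0 ↔ z = x₀ := by rw [Fin.ext_iff, h₀]
  by_cases h1 : z = x₀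
  · subst h1
    simp [tiltedState, twoLevel, h₀, h.symm]
  · by_cases h2 : z = x
    · subst h2
      simp [tiltedState, twoLevel, likelihood_markTable hb, hz, h]
    · simp [tiltedState, twoLevel, likelihood_markTable hb, hz, h1, h2]

theorem norm_inv_norm_smul_sub_self {ι : Type} [Fintype ι] (ψ : Space ι) (h1 : ‖ψ‖ ≤ 1)
    (h0 : ψ ≠ 0) : ‖((‖ψ‖⁻¹ : ℝ) : ℂ) • ψ - ψ‖ = 1 - ‖ψ‖ := by
  have hp : 0 < ‖ψ‖ := norm_pos_iff.2 h0
  have h : ((‖ψ‖⁻¹ : ℝ) : ℂ) • ψ - ψ = ((‖ψ‖⁻¹ - 1 : ℝ) : ℂ) • ψ := by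
    rw [Complex.ofReal_sub, Complex.ofReal_one, sub_smul, one_smul]
  rw [h, norm_smul, Complex.norm_real, Real.norm_eq_abs,
    abs_of_nonneg (sub_nonneg.2 ((one_le_inv₀ hp).2 h1)), sub_mul, inv_mul_cancel₀ hp.ne', one_mul]

section Failure

variable {N b : ℕ} (A : Heralded (Fin N) N b) {x₀ x : Fin N}

/-- The success of an update of `c|x₀⟩ + s|x⟩` is due to its component `s|x⟩`, since `x` is not
found in the state `|x₀⟩`. -/
theorem Heralded.norm_succeeded_twoLevel_le (hb : 1 ≤ b) {c s : ℝ}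
    (hc : |c| ≤ 1) (hs : 0 ≤ s) (hA : A.Updates (markTable x) (twoLevel x₀ x c s)) :
    ‖A.succeeded (markTable x) (twoLevel x₀ x c s)‖ ≤
      s + 2 * A.neverHalting.visits (EuclideanSpace.single x₀ 1) A.queries x +
      ‖sysProj x (A.run (nullTable N b) (EuclideanSpace.single x₀ 1) A.queries)‖ := by
  rw [← hA.sysProj_eq (posterior_markTable hb x _)]
  have hlin : A.succeeded (markTable x) (twoLevel x₀ x c s) =
      (c : ℂ) • A.succeeded (markTable x) (EuclideanSpace.single x₀ 1) +
        (s : ℂ) • A.succeeded (markTable x) (EuclideanSpace.single x 1) := by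
    simp only [Heralded.succeeded, twoLevel, Circuit.run_add, Circuit.run_smul, component_add,
      component_smul]
  rw [hlin, map_add, map_smul, map_smul]
  refine (norm_add_le _ _).trans ?_
  rw [norm_smul, norm_smul, Complex.norm_real, Complex.norm_real, Real.norm_eq_abs,
    Real.norm_eq_abs, abs_of_nonneg hs]
  have h1 := A.norm_sysProj_succeeded_le x (EuclideanSpace.single x₀ 1)
  have h2 : ‖sysProj x (A.succeeded (markTable x) (EuclideanSpace.single x 1))‖ ≤ 1 := by
    refine (norm_sysProj_le _ _).trans ((norm_component_le _ _).trans ?_)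
    simp [Circuit.norm_run]
  have h3 := mul_le_of_le_one_left
    (norm_nonneg (sysProj x (A.succeeded (markTable x) (EuclideanSpace.single x₀ 1)))) hc
  have h4 := mul_le_of_le_one_right hs h2
  linarith

/-- A failed update of `c|x₀⟩ + s|x⟩` leaves a state whose distance from a state independent of
`x` is `s`, damped by the failure amplitude on `|x⟩`, up to the effect of few queries on `|x₀⟩`. -/
theorem Heralded.norm_failed_twoLevel_sub_le {c s : ℝ} (hc : |c| ≤ 1) (hs : 0 ≤ s) :
    ‖A.failed (markTable x) (twoLevel x₀ x c s) -
        (c : ℂ) • A.failed (nullTable N b) (EuclideanSpace.single x₀ 1)‖ ≤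
      2 * A.neverHalting.visits (EuclideanSpace.single x₀ 1) A.queries x +
        s * ‖A.failed (markTable x) (EuclideanSpace.single x 1)‖ := by
  have hlin : A.failed (markTable x) (twoLevel x₀ x c s) -
      (c : ℂ) • A.failed (nullTable N b) (EuclideanSpace.single x₀ 1) =
      (c : ℂ) • component A.successᶜ
          (A.run (markTable x) (EuclideanSpace.single x₀ 1) A.queries -
            A.run (nullTable N b) (EuclideanSpace.single x₀ 1) A.queries) +
        (s : ℂ) • A.failed (markTable x) (EuclideanSpace.single x 1) := by
    simp only [Heralded.failed, twoLevel, Circuit.run_add, Circuit.run_smul, component_add,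
      component_smul, component_sub, smul_sub]
    abel
  rw [hlin]
  refine (norm_add_le _ _).trans ?_
  rw [norm_smul, norm_smul, Complex.norm_real, Complex.norm_real, Real.norm_eq_abs,
    Real.norm_eq_abs, abs_of_nonneg hs]
  refine add_le_add_left ((mul_le_of_le_one_left (norm_nonneg _) hc).trans ?_) _
  exact (norm_component_le _ _).trans (A.norm_run_sub_run_le x _ _)

/-- Normalisation after a failed update costs only a second order in `s`. -/
theorem Heralded.norm_failedState_twoLevel_sub_le (hb : 1 ≤ b) (hx : x ≠ x₀) {c s r η : ℝ}
    (hs : 0 < s) (hcs : c ^ 2 + s ^ 2 = 1) (hη : 0 ≤ η) (hsη : s + 9 * η < 1)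
    (hA : A.Updates (markTable x) (twoLevel x₀ x c s))
    (hr : ‖A.failed (markTable x) (EuclideanSpace.single x 1)‖ ≤ r)
    (hg : A.neverHalting.visits (EuclideanSpace.single x₀ 1) A.queries x ≤ 3 * η)
    (he : ‖sysProj x (A.run (nullTable N b) (EuclideanSpace.single x₀ 1) A.queries)‖ ≤ 3 * η) :
    A.failed (markTable x) (twoLevel x₀ x c s) ≠ 0 ∧
      ‖A.failedState (markTable x) (twoLevel x₀ x c s) -
        (c : ℂ) • A.failed (nullTable N b) (EuclideanSpace.single x₀ 1)‖ ≤
      (s + 9 * η) ^ 2 + 6 * η + s * r := by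
  have hc : |c| ≤ 1 := by
    rw [← sq_le_one_iff_abs_le_one]
    nlinarith
  have hsucc := A.norm_succeeded_twoLevel_le hb hc hs.le hA
  have h1 := A.norm_failed_twoLevel_sub_le (x₀ := x₀) (x := x) hc hs.le
  have hfail := A.norm_sq_succeeded_add (markTable x) (twoLevel x₀ x c s)
  rw [norm_twoLevel hx hcs, one_pow] at hfail
  rw [Heralded.failedState]
  set ψ := A.failed (markTable x) (twoLevel x₀ x c s)
  have hsucc2 : ‖A.succeeded (markTable x) (twoLevel x₀ x c s)‖ ^ 2 ≤ (s + 9 * η) ^ 2 :=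
    pow_le_pow_left₀ (norm_nonneg _) (by linarith) 2
  have h0 : ψ ≠ 0 := by
    intro h
    rw [h, norm_zero] at hfail
    nlinarith
  have hψ : ‖ψ‖ ≤ 1 := by
    rw [← sq_le_one_iff₀ (norm_nonneg _)]
    linarith [sq_nonneg ‖A.succeeded (markTable x) (twoLevel x₀ x c s)‖]
  refine ⟨h0, (norm_sub_le_norm_sub_add_norm_sub _ ψ _).trans ?_⟩
  rw [norm_inv_norm_smul_sub_self ψ hψ h0]
  have h2 := mul_le_mul_of_nonneg_left hr hs.le
  have h3 : 1 - ‖ψ‖ ≤ (s + 9 * η) ^ 2 := by nlinarith [norm_nonneg ψ]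
  linarith

end Failure

/-- An algorithm whose output is `c|x₀⟩ + s|x⟩` has moved away from its run on the null table by
the amplitude of `|x⟩`. -/
theorem Adaptive.mul_one_sub_le_of_outputs_twoLevel {κ : Type} [Fintype κ] {N b : ℕ}
    (B : Adaptive κ N b) {x₀ x : Fin N} (hx : x ≠ x₀) {c s : ℝ} (hcs : c ^ 2 + s ^ 2 = 1)
    {v : Space κ} (hv : ‖v‖ = 1) (u : Space κ) {h η : ℝ} {T : ℕ} (hη0 : 0 ≤ η) (hη1 : η ≤ 1)
    (hout : B.Outputs (markTable x) v (twoLevel x₀ x c s))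
    (hB : B.expectedQueries (markTable x) v ≤ ENNReal.ofReal h) (hT : 0 < T)
    (hη : |h| ≤ η * T) :
    s * (1 - η) ≤ ‖v - u‖ + 2 * B.visits u T x + B.hits u T x := by
  refine le_trans ?_ (B.sqrt_sum_norm_sq_sysProj_stopped_le x v u T)
  have h2 := B.one_sub_le_sum_norm_sq_stopped (markTable x) hv hB hT hη
  have hst : ∀ t, ‖sysProj x (B.stopped (markTable x) v t)‖ ^ 2 =
      s ^ 2 * ‖B.stopped (markTable x) v t‖ ^ 2 := fun t => by
    rw [(hout t).norm_sq_sysProj (norm_twoLevel hx hcs) x, twoLevel_apply_right hx,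
      Complex.norm_real, Real.norm_eq_abs, sq_abs]
  simp only [hst]
  rw [← Finset.mul_sum]
  refine Real.le_sqrt_of_sq_le ?_
  rw [mul_pow]
  refine mul_le_mul_of_nonneg_left (le_trans ?_ h2) (sq_nonneg s)
  nlinarith

theorem isLittleO_sqrt_of_isLittleO_sqrt_div_log {h : ℕ → ℝ}
    (hh : h =o[atTop] (fun N => √(N : ℝ) / Real.log N)) : h =o[atTop] (fun N => √(N : ℝ)) := by
  refine hh.trans_isBigO (IsBigO.of_bound 1 ?_)
  filter_upwards [(Real.tendsto_log_atTop.comp tendsto_natCast_atTop_atTop).eventually_ge_atTop 1]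
    with N hN
  rw [norm_div, one_mul]
  refine div_le_self (norm_nonneg _) ?_
  exact hN.trans (Real.le_norm_self _)

/-- For small `s` the gain `s - s r` in the amplitude of `|x⟩` exceeds the loss `s²` from
normalisation and the errors of order `η`. -/
theorem not_amplitude_gain_le {s r η : ℝ} (hs0 : 0 < s) (hs1 : s ≤ 1 / 2) (hr : r = 1 - 2 * s)
    (hη : η = s ^ 2 / 100) :
    ¬ s * (1 - η) ≤ (s + 9 * η) ^ 2 + 6 * η + s * r + 2 * (3 * η) + 3 * η := by
  subst hr
  intro h
  have hη0 : 0 < η := by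
    rw [hη]
    positivity
  have hη1 : η ≤ 1 / 400 := by nlinarith
  have h1 : s ^ 2 ≤ η * (19 * s + 81 * η + 15) := by linarith
  have h2 : η * (19 * s + 81 * η + 15) ≤ η * 99 :=
    mul_le_mul_of_nonneg_left (by linarith) hη0.le
  nlinarith

/-- Undoing a failed update restores an amplitude of `|x⟩` that the failure has damped. On the
state `c|x₀⟩ + s|x⟩` with small `s`, this moves a state at distance at most about `s √(1 - p)` from
one independent of `x`, where `p` is the success probability on `|x⟩`, to distance at least about
`s`; that takes `Ω(√N)` queries. -/
theorem not_isUndoAlgorithm {b : ℕ → ℕ} (hb : ∀ N, 1 ≤ b N)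
    {F : ∀ N, ℝ → Heralded (Fin N) N (b N)} (hF : IsUpdateAlgorithm b F)
    (H : ∀ N Γ, (Table N (b N) → Space (Fin N)) →
      Adaptive (Reg N (b N) ((F N Γ).w (F N Γ).queries)) N (b N)) :
    ¬ IsUndoAlgorithm b F H := by
  rintro ⟨q, hq, hH⟩
  obtain ⟨T', hT'⟩ := hF.queries_bounded
  obtain ⟨p, hp, N₀, hN₀⟩ := hF.success_bigOmega
  -- `r` bounds the failure amplitude on `|x⟩`; the choice of `s` makes `s - s r - s² = s²`.
  obtain ⟨r, hr⟩ : ∃ r, r = √(1 - p) := ⟨_, rfl⟩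
  have hr0 : 0 ≤ r := hr ▸ Real.sqrt_nonneg _
  have hr1 : r < 1 := by
    rw [hr, Real.sqrt_lt' one_pos]
    linarith
  obtain ⟨s, hs⟩ : ∃ s, s = (1 - r) / 2 := ⟨_, rfl⟩
  have hs0 : 0 < s := by linarith
  have hs1 : s ≤ 1 / 2 := by linarith
  obtain ⟨c, hc⟩ : ∃ c, c = √(1 - s ^ 2) := ⟨_, rfl⟩
  have hcs : c ^ 2 + s ^ 2 = 1 := by
    rw [hc, Real.sq_sqrt (by nlinarith)]
    ring
  have hc1 : |c| ≤ 1 := by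
    rw [← sq_le_one_iff_abs_le_one]
    nlinarith
  obtain ⟨η, hη⟩ : ∃ η, η = s ^ 2 / 100 := ⟨_, rfl⟩
  have hη0 : 0 < η := by
    rw [hη]
    positivity
  have hη1 : η ≤ 1 / 400 := by nlinarith
  obtain ⟨N, ⟨T, hT0, hqT, hT⟩, hN2, hNN₀⟩ := ((eventually_exists_truncation
    (isLittleO_sqrt_of_isLittleO_sqrt_div_log hq) (T' ^ 2 + 2) hη0).and
    ((eventually_ge_atTop 2).and (eventually_ge_atTop N₀))).exists
  have hN : (0 : ℝ) < N := by exact_mod_cast (by omega : 0 < N)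
  obtain ⟨x₀, hx₀⟩ : ∃ x₀ : Fin N, (x₀ : ℕ) = 0 := ⟨⟨0, by omega⟩, rfl⟩
  have hqb := hT' N 1 one_pos le_rfl
  have hup := hF.updates N 1
  have hpN := hN₀ N hNN₀ 1
  have hHN := fun P => hH N 1 P (tiltedState c s)
  generalize H N 1 (tiltedState c s) = B at hHN
  clear hH H hF
  generalize F N 1 = A at B hHN hqb hup hpN
  obtain ⟨v, hv⟩ : ∃ v : Space (Fin N), v = EuclideanSpace.single x₀ 1 := ⟨_, rfl⟩
  have hv1 : ‖v‖ = 1 := by simp [hv]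
  obtain ⟨u, hu⟩ : ∃ u, u = (c : ℂ) • A.failed (nullTable N (b N)) v := ⟨_, rfl⟩
  have hu1 : ‖u‖ ^ 2 ≤ 1 := by
    rw [hu, norm_smul, Complex.norm_real, Real.norm_eq_abs]
    refine pow_le_one₀ (by positivity)
      (mul_le_one₀ hc1 (norm_nonneg _) ((norm_component_le _ _).trans ?_))
    rw [Circuit.norm_run, hv1]
  have hsum : ∑ x, (A.neverHalting.visits v A.queries x ^ 2 +
      ‖sysProj x (A.run (nullTable N (b N)) v A.queries)‖ ^ 2 +
      B.visits u T x ^ 2 + B.hits u T x ^ 2) ≤ T ^ 2 + (T' ^ 2 + 2) := by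
    rw [Finset.sum_add_distrib, Finset.sum_add_distrib, Finset.sum_add_distrib,
      sum_norm_sq_sysProj, Circuit.norm_run, hv1]
    have h1 := A.neverHalting.sum_visits_sq_le v A.queries
    have h2 : (A.queries : ℝ) ^ 2 ≤ T' ^ 2 :=
      pow_le_pow_left₀ (Nat.cast_nonneg _) (by exact_mod_cast hqb) 2
    have h3 := B.sum_visits_sq_le u T
    have h4 := B.sum_hits_sq_le u T
    have h5 := mul_le_of_le_one_right (sq_nonneg (T : ℝ)) hu1
    rw [hv1] at h1
    linarith
  obtain ⟨x, hx, hxN⟩ := exists_ne_mul_le_of_sum_le hN2 (fun x => by positivity) hsum x₀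
  have hsmall := le_of_mul_le_mul_left (hxN.trans (hT.trans (mul_comm _ _).le)) hN
  have hn1 := sq_nonneg (A.neverHalting.visits v A.queries x)
  have hn2 := sq_nonneg ‖sysProj x (A.run (nullTable N (b N)) v A.queries)‖
  have hn3 := sq_nonneg (B.visits u T x)
  have hn4 := sq_nonneg (B.hits u T x)
  have hle : ∀ {y : ℝ}, y ^ 2 ≤ 9 * η ^ 2 → y ≤ 3 * η := fun {y} hy =>
    (abs_le_of_sq_le_sq' (by linarith) (by positivity)).2
  have hadm : Admissible 1 (markTable x : Table N (b N)) (twoLevel x₀ x c s) :=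
    admissible_markTable (hb N) (norm_twoLevel hx hcs) (by
      rw [twoLevel_apply_right hx]
      exact Complex.ofReal_ne_zero.2 hs0.ne')
  have hdamp : ‖A.failed (markTable x) (EuclideanSpace.single x 1)‖ ≤ r := by
    have hx1 : ‖(EuclideanSpace.single x 1 : Space (Fin N))‖ = 1 := by simp
    have h1 := hpN (markTable x) _ (admissible_markTable (hb N) hx1 (by simp))
    have h2 := A.norm_sq_succeeded_add (markTable x) (EuclideanSpace.single x 1)
    rw [evidence_markTable (hb N), Heralded.successProb] at h1
    rw [hx1] at h2
    simp only [PiLp.single_apply, if_true, norm_one, one_pow, div_one, mul_one] at h1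
    rw [hr]
    refine Real.le_sqrt_of_sq_le ?_
    linarith
  obtain ⟨h0, hdist⟩ := A.norm_failedState_twoLevel_sub_le (hb N) hx hs0 hcs hη0.le
    (by linarith) (hup _ _ hadm) hdamp
    (hv ▸ hle (by linarith)) (hv ▸ hle (by linarith))
  rw [← hv, ← hu] at hdist
  have hunit : ‖A.failedState (markTable x) (twoLevel x₀ x c s)‖ = 1 := by
    rw [Heralded.failedState, norm_smul, Complex.norm_real, norm_inv, norm_norm,
      inv_mul_cancel₀ (norm_ne_zero_iff.2 h0)]
  have hHx := hHN (markTable x)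
  rw [tiltedState_markTable (hb N) hx₀ hx] at hHx
  obtain ⟨hout, hexp⟩ := hHx hadm h0
  have h1 := B.mul_one_sub_le_of_outputs_twoLevel hx hcs hunit u hη0.le (by linarith) hout hexp
    hT0 hqT
  have h2 : B.visits u T x ≤ 3 * η := hle (by linarith)
  have h3 : B.hits u T x ≤ 3 * η := hle (by linarith)
  exact not_amplitude_gain_le hs0 hs1 (show r = 1 - 2 * s by linarith) hη (by linarith)

end QBayes

theorem mainTheorem1 (b : ℕ → ℕ) (hb : ∀ N, 1 ≤ b N)
    (F : ∀ N, ℝ → QBayes.Heralded (Fin N) N (b N)) (hF : QBayes.IsUpdateAlgorithm b F) :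
    (¬ ∃ G : ∀ N, ℝ → QBayes.Space (Fin N) → QBayes.Heralded (Fin N) N (b N),
        QBayes.IsImprovedUpdateAlgorithm b G) ∧
    (¬ ∃ H : ∀ N Γ, (QBayes.Table N (b N) → QBayes.Space (Fin N)) →
          QBayes.Adaptive (QBayes.Reg N (b N) ((F N Γ).w (F N Γ).queries)) N (b N),
        QBayes.IsUndoAlgorithm b F H) ∧
    (¬ ∃ I : ∀ N, ℝ → QBayes.Space (Fin N) → QBayes.Adaptive (Fin N) N (b N),
        QBayes.IsAverageUpdateAlgorithm b I) := by
  exact ⟨fun ⟨G, hG⟩ => QBayes.not_isImprovedUpdateAlgorithm hb G hG,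
    fun ⟨H, hH⟩ => QBayes.not_isUndoAlgorithm hb hF H hH,
    fun ⟨I, hI⟩ => QBayes.not_isAverageUpdateAlgorithm hb I hI⟩
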